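/- Let $\mathbb{X}$ be a locally compact Polish space with its Borel $\sigma$-algebra and let $k:\mathbb{X}\times\mathbb{X}\to\mathbb{R}$ be a bounded, measurable, symmetric, positive-definite kernel with reproducing kernel Hilbert space $\mathbb{H}_k$. For a probability measure $p$ on $\mathbb{X}$ let $\mu_k(p)\in\mathbb{H}_k$ be its kernel mean embedding, $\mu_k(p)(y)=\int k(x,y)\,\mathrm{d}p(x)$. For random probability measures $\tilde P_1,\tilde P_2$ on $\mathbb{X}$, defined on a common probability space, put $$\mathrm{Cov}_k(\tilde P_1,\tilde P_2)=\mathbb{E}\bigl[\langle \mu_k(\tilde P_1)-\mathbb{E}[\mu_k(\tilde P_1)],\,\mu_k(\tilde P_2)-\mathbb{E}[\mu_k(\tilde P_2)]\rangle_{\mathbb{H}_k}\bigr],\qquad \mathrm{Var}_k(\tilde P_i)=\mathrm{Cov}_k(\tilde P_i,\tilde P_i),$$ where the mean $\mathbb{E}[Y]$ of a random element $Y$ of $\mathbb{H}_k$ is the element with $\langle \mathbb{E}[Y],f\rangle=\mathbb{E}\langle Y,f\rangle$ for all $f\in\mathbb{H}_k$, and, when $\mathrm{Var}_k(\tilde P_1),\mathrm{Var}_k(\tilde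 P_2)>0$, $$\mathrm{Corr}_k(\tilde P_1,\tilde P_2)=\frac{\mathrm{Cov}_k(\tilde P_1,\tilde P_2)}{\sqrt{\mathrm{Var}_k(\tilde P_1)}\sqrt{\mathrm{Var}_k(\tilde P_2)}}.$$ Let $\bigl(X^{(t)}_{1,1},X^{(t)}_{2,1},X^{(t)}_{1,2},X^{(t)}_{2,2}\bigr)$, $t=1,2,\dots$, be independent random vectors, each distributed as a $2\times 2$ sample from the partially exchangeable model: given $(\tilde P_1,\tilde P_2)$, the $X_{i,j}$ are independent with $X_{i,j}\sim\tilde P_i$. For $M\ge 2$ set $$\widehat{\mathrm{Cov}}_{k,M}=\frac{1}{M-1}\sum_{t=1}^{M}k\bigl(X^{(t)}_{1,1},X^{(t)}_{2,1}\bigr)-\frac{1}{(M-1)M}\sum_{t=1}^{M}\sum_{s=1}^{M}k\bigl(X^{(t)}_{1,1},X^{(s)}_{2,1}\bigr),$$ $$\widehat{\mathrm{Var}}_{k,M,i}=\frac{1}{M-1}\sum_{t=1}^{M}k\bigl(X^{(t)}_{i,1},X^{(t)}_{i,2}\bigr)-\frac{1}{(M-1)M}\sum_{t=1}^{M}\sum_{s=1}^{M}k\bigl(X^{(t)}_{i,1},X^{(s)}_{i,2}\bigr),\quad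 i=1,2,$$ $$\widehat{\mathrm{Corr}}_{k,M}=\frac{\widehat{\mathrm{Cov}}_{k,M}}{\sqrt{\widehat{\mathrm{Var}}_{k,M,1}}\sqrt{\widehat{\mathrm{Var}}_{k,M,2}}}$$ (with the convention that $\widehat{\mathrm{Corr}}_{k,M}=0$ when one of the two variance estimates is not positive). If $\mathrm{Var}_k(\tilde P_i)>0$ for $i=1,2$, then $\sqrt{M}\,\bigl(\widehat{\mathrm{Corr}}_{k,M}-\mathrm{Corr}_k(\tilde P_1,\tilde P_2)\bigr)$ converges in distribution, as $M\to\infty$, to a centred (possibly degenerate) Gaussian distribution $N(0,v)$, $v\ge 0$. -/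

import Mathlib

open MeasureTheory ProbabilityTheory Filter Topology

noncomputable section

namespace KernelCorr

/-- A kernel on a measurable space: a jointly measurable real function of two variables that is
bounded, symmetric and positive-definite (in the usual sense of reproducing kernels, i.e. all
its finite Gram matrices are positive semidefinite). -/
structure BddKernel (𝕏 : Type*) [MeasurableSpace 𝕏] where
  /-- The underlying function of two variables. -/
  toFun : 𝕏 → 𝕏 → ℝ
  measurable : Measurable (Function.uncurry toFun)
  bounded : ∃ C : ℝ, ∀ x y, |toFun x y| ≤ C
  symm : ∀ x y, toFun x y = toFun y x
  posDef : ∀ (s : Finset 𝕏) (c : 𝕏 → ℝ), 0 ≤ ∑ x ∈ s, ∑ y ∈ s, c x * c y * toFun x y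

instance {𝕏 : Type*} [MeasurableSpace 𝕏] : CoeFun (BddKernel 𝕏) (fun _ => 𝕏 → 𝕏 → ℝ) :=
  ⟨BddKernel.toFun⟩

namespace BddKernel

variable {𝕏 : Type*} [MeasurableSpace 𝕏] (k : BddKernel 𝕏)

/-- The kernel as a matrix of (scalar) operators on `ℝ`, the format in which Mathlib builds
reproducing kernel Hilbert spaces. -/
def matrix : Matrix 𝕏 𝕏 (ℝ →L[ℝ] ℝ) :=
  Matrix.of fun x y => k x y • ContinuousLinearMap.id ℝ ℝ

instance fact_posSemidef : Fact k.matrix.PosSemidef := by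
  have h02 := (RKHS.posSemidef_tfae (𝕜 := ℝ) (K := k.matrix)).out 0 2
  refine ⟨h02.mpr ⟨?_, fun c => ?_⟩⟩
  · ext x y
    simp [matrix, k.symm x y, ← ContinuousLinearMap.one_def]
  · have h := k.posDef c.support c
    simp only [Finsupp.sum, matrix]
    refine h.trans_eq ?_
    simp only [Matrix.of_apply, RCLike.re_to_real]
    refine Finset.sum_congr rfl fun x _ => Finset.sum_congr rfl fun y _ => ?_
    simp [k.symm y x]
    ring

/-- The reproducing kernel Hilbert space `ℍ_k` of the kernel `k`. -/
abbrev Space : Type _ := RKHS.OfKernel k.matrix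

lemma norm_apply_le {C : ℝ} (hC : ∀ x y, |k x y| ≤ C) (f : k.Space) (x : 𝕏) :
    ‖f x‖ ≤ √C * ‖f‖ := by
  refine (RKHS.norm_apply_le f x).trans ?_
  rw [mul_comm, RKHS.OfKernel.kernel_ofKernel]
  gcongr
  refine ContinuousLinearMap.opNorm_le_bound _ ((abs_nonneg _).trans (hC x x)) fun v => ?_
  simp only [matrix, Matrix.of_apply]
  simpa using mul_le_mul_of_nonneg_right (hC x x) (abs_nonneg v)

/-- The elements of `ℍ_k` are measurable functions. -/
lemma measurable_coe (f : k.Space) : Measurable (f : 𝕏 → ℝ) := by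
  have hf : f ∈ closure ((Submodule.span ℝ {RKHS.kerFun k.Space x v | (x) (v)} :
      Submodule ℝ k.Space) : Set k.Space) := by
    rw [← Submodule.topologicalClosure_coe, RKHS.kerFun_dense]
    trivial
  obtain ⟨g, hg, hlim⟩ := mem_closure_iff_seq_limit.mp hf
  refine measurable_of_tendsto_metrizable (f := fun n => (g n : 𝕏 → ℝ)) (fun n => ?_)
    (tendsto_pi_nhds.mpr fun x => ((RKHS.continuous_eval x).tendsto f).comp hlim)
  have hgn := hg n
  generalize g n = h at hgn
  induction hgn using Submodule.span_induction with
  | mem h hh =>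
    obtain ⟨x, v, rfl⟩ := hh
    have h1 : ((RKHS.kerFun k.Space x v : k.Space) : 𝕏 → ℝ) = fun y => k y x * v := by
      funext y
      rw [RKHS.kerFun_apply, RKHS.OfKernel.kernel_ofKernel]
      simp [matrix]
    rw [h1]
    exact (k.measurable.comp (measurable_id.prodMk measurable_const)).mul_const v
  | zero =>
    rw [RKHS.coe_zero]
    exact measurable_zero
  | add a b _ _ ha hb => simpa using ha.add hb
  | smul c a _ ha => simpa using ha.const_smul c

lemma integrable_coe (ξ : Measure 𝕏) [IsFiniteMeasure ξ] (f : k.Space) :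
    Integrable (f : 𝕏 → ℝ) ξ := by
  obtain ⟨C, hC⟩ := k.bounded
  exact Integrable.of_bound (k.measurable_coe f).aestronglyMeasurable (√C * ‖f‖)
    (Eventually.of_forall fun x => k.norm_apply_le hC f x)

/-- Every finite measure has a kernel mean embedding in `ℍ_k`, and it represents integration. -/
lemma exists_meanEmbedding (ξ : Measure 𝕏) [IsFiniteMeasure ξ] :
    ∃ g : k.Space, (∀ y, g y = ∫ x, k x y ∂ξ) ∧ ∀ f : k.Space, inner ℝ g f = ∫ x, f x ∂ξ := by
  obtain ⟨C, hC⟩ := k.bounded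
  let L : k.Space →ₗ[ℝ] ℝ :=
    { toFun := fun f => ∫ x, f x ∂ξ
      map_add' := fun f g => by
        simpa using integral_add (k.integrable_coe ξ f) (k.integrable_coe ξ g)
      map_smul' := fun c f => by simpa using integral_const_mul c (fun x => f x) }
  let L' : k.Space →L[ℝ] ℝ := L.mkContinuous (√C * ‖(1 : ℝ)‖ * ξ.real Set.univ) fun f => by
    have := norm_integral_le_of_norm_le_const (μ := ξ) (f := fun x => f x)
      (Eventually.of_forall fun x => k.norm_apply_le hC f x)
    refine this.trans_eq ?_
    simp
    ring
  refine ⟨(InnerProductSpace.toDual ℝ k.Space).symm L', ?_, ?_⟩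
  · intro y
    have h1 : ((InnerProductSpace.toDual ℝ k.Space).symm L' : k.Space) y =
        inner ℝ ((InnerProductSpace.toDual ℝ k.Space).symm L') (RKHS.kerFun k.Space y 1) := by
      rw [RKHS.inner_kerFun]
      simp
    rw [h1, InnerProductSpace.toDual_symm_apply]
    change ∫ x, (RKHS.kerFun k.Space y 1 : k.Space) x ∂ξ = _
    refine integral_congr_ae (Eventually.of_forall fun x => ?_)
    simp only
    rw [RKHS.kerFun_apply, RKHS.OfKernel.kernel_ofKernel]
    simp [matrix]
  · intro f
    rw [InnerProductSpace.toDual_symm_apply]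
    rfl

/-- The kernel mean embedding `μ_k(p) ∈ ℍ_k` of a probability measure `p`: the (unique) element of
`ℍ_k` which as a function is `y ↦ ∫ k(x, y) dp(x)`. -/
def meanEmbedding (p : ProbabilityMeasure 𝕏) : k.Space :=
  (k.exists_meanEmbedding (p : Measure 𝕏)).choose

lemma meanEmbedding_apply (p : ProbabilityMeasure 𝕏) (y : 𝕏) :
    k.meanEmbedding p y = ∫ x, k x y ∂(p : Measure 𝕏) :=
  (k.exists_meanEmbedding (p : Measure 𝕏)).choose_spec.1 y

lemma inner_meanEmbedding (p : ProbabilityMeasure 𝕏) (f : k.Space) :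
    inner ℝ (k.meanEmbedding p) f = ∫ x, f x ∂(p : Measure 𝕏) :=
  (k.exists_meanEmbedding (p : Measure 𝕏)).choose_spec.2 f

end BddKernel

section Mean

variable {Ω H : Type*} [MeasurableSpace Ω] [NormedAddCommGroup H] [InnerProductSpace ℝ H]

/-- `m` is the mean `𝔼[Y]` of the random element `Y` of the Hilbert space `H`:
`⟨m, f⟩ = 𝔼⟨Y, f⟩` for every `f ∈ H`. (This is the weak, or Pettis, mean. It is the Bochner mean
whenever that exists, and it also makes sense for non-separable `H`.) -/
def IsMean (μ : Measure Ω) (Y : Ω → H) (m : H) : Prop :=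
  ∀ f : H, Integrable (fun ω => inner ℝ (Y ω) f) μ ∧ inner ℝ m f = ∫ ω, inner ℝ (Y ω) f ∂μ

open Classical in
/-- The mean `𝔼[Y]` of a random element `Y` of a Hilbert space (`0` if there is none). -/
def mean (μ : Measure Ω) (Y : Ω → H) : H :=
  if h : ∃ m, IsMean μ Y m then h.choose else 0

end Mean

section Correlation

variable {Ω 𝕏 : Type*} [MeasurableSpace Ω] [MeasurableSpace 𝕏] (k : BddKernel 𝕏)

/-- The mean of the kernel mean embedding of a random probability measure exists. -/
lemma isMean_meanEmbedding (μ : Measure Ω) [IsProbabilityMeasure μ]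
    {P : Ω → ProbabilityMeasure 𝕏} (hP : Measurable P) :
    IsMean μ (fun ω => k.meanEmbedding (P ω)) (mean μ fun ω => k.meanEmbedding (P ω)) := by
  suffices h : ∃ m, IsMean μ (fun ω => k.meanEmbedding (P ω)) m by
    rw [mean, dif_pos h]
    exact h.choose_spec
  let κ : Kernel Ω 𝕏 := ⟨fun ω => (P ω : Measure 𝕏), measurable_subtype_coe.comp hP⟩
  have : IsMarkovKernel κ := ⟨fun ω => inferInstanceAs (IsProbabilityMeasure (P ω : Measure 𝕏))⟩
  obtain ⟨C, hC⟩ := k.bounded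
  have hbd (f : k.Space) (ω : Ω) : ‖inner ℝ (k.meanEmbedding (P ω)) f‖ ≤ √C * ‖f‖ := by
    rw [k.inner_meanEmbedding]
    simpa using norm_integral_le_of_norm_le_const (μ := (P ω : Measure 𝕏)) (f := fun x => f x)
      (Eventually.of_forall fun x => k.norm_apply_le hC f x)
  have hint (f : k.Space) : Integrable (fun ω => inner ℝ (k.meanEmbedding (P ω)) f) μ := by
    refine Integrable.of_bound ?_ (√C * ‖f‖) (Eventually.of_forall (hbd f))
    simp only [k.inner_meanEmbedding]
    exact (StronglyMeasurable.integral_kernel (κ := κ)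
      (k.measurable_coe f).stronglyMeasurable).aestronglyMeasurable
  let L : k.Space →ₗ[ℝ] ℝ :=
    { toFun := fun f => ∫ ω, inner ℝ (k.meanEmbedding (P ω)) f ∂μ
      map_add' := fun f g => by
        simp only [inner_add_right]
        exact integral_add (hint f) (hint g)
      map_smul' := fun c f => by
        simp only [inner_smul_right, RingHom.id_apply, smul_eq_mul]
        exact integral_const_mul c _ }
  let L' : k.Space →L[ℝ] ℝ := L.mkContinuous (√C) fun f => by
    have h := norm_integral_le_of_norm_le_const (μ := μ)
      (f := fun ω => inner ℝ (k.meanEmbedding (P ω)) f) (Eventually.of_forall (hbd f))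
    rwa [probReal_univ, mul_one] at h
  refine ⟨(InnerProductSpace.toDual ℝ k.Space).symm L', fun f => ⟨hint f, ?_⟩⟩
  rw [InnerProductSpace.toDual_symm_apply]
  rfl

/-- The kernel covariance
`Cov_k(P₁, P₂) = 𝔼 ⟨μ_k(P₁) - 𝔼[μ_k(P₁)], μ_k(P₂) - 𝔼[μ_k(P₂)]⟩` of two random probability
measures, the inner product being that of `ℍ_k`. -/
def kernelCov (μ : Measure Ω) (P₁ P₂ : Ω → ProbabilityMeasure 𝕏) : ℝ :=
  ∫ ω, inner ℝ
    (k.meanEmbedding (P₁ ω) - mean μ fun ω' => k.meanEmbedding (P₁ ω'))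
    (k.meanEmbedding (P₂ ω) - mean μ fun ω' => k.meanEmbedding (P₂ ω')) ∂μ

/-- The kernel variance `Var_k(P) = Cov_k(P, P)`. -/
def kernelVar (μ : Measure Ω) (P : Ω → ProbabilityMeasure 𝕏) : ℝ :=
  kernelCov k μ P P

/-- The kernel correlation `Corr_k(P₁, P₂)`. -/
def kernelCorr (μ : Measure Ω) (P₁ P₂ : Ω → ProbabilityMeasure 𝕏) : ℝ :=
  kernelCov k μ P₁ P₂ / (√(kernelVar k μ P₁) * √(kernelVar k μ P₂))

end Correlation

section Sampling

variable {Ω Ω' 𝕏 : Type*} [MeasurableSpace Ω] [MeasurableSpace Ω'] [MeasurableSpace 𝕏]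

/-- The random variables `X i j` (group `i`, observation `j`) on `(Ω', ν)` are a `2 × 2` sample
from the partially exchangeable model directed by the random probability measures `P 0, P 1` on
`(Ω, μ)`: given random probability measures with the joint law `Q` of `(P 0, P 1)`, they are
conditionally independent and `X i j` has conditional law `P i`. Integrating `Q` out, this says
that their joint law is the mixture `∫ p₀ ⊗ p₀ ⊗ p₁ ⊗ p₁ Q(dp₀, dp₁)`. -/
structure IsPartiallyExchangeableSample (μ : Measure Ω) (P : Fin 2 → Ω → ProbabilityMeasure 𝕏)
    (ν : Measure Ω') (X : Fin 2 → Fin 2 → Ω' → 𝕏) : Prop where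
  measurable : ∀ i j, Measurable (X i j)
  law : ∀ A : Fin 2 → Fin 2 → Set 𝕏, (∀ i j, MeasurableSet (A i j)) →
    ν {ω' | ∀ i j, X i j ω' ∈ A i j} =
      ∫⁻ ω, ∏ i, ∏ j, (P i ω : Measure 𝕏) (A i j) ∂μ

end Sampling

section Estimators

variable {𝕏 : Type*} [MeasurableSpace 𝕏] (k : BddKernel 𝕏)

/-- `1/(M-1) ∑ₜ k(yₜ, zₜ) - 1/((M-1)M) ∑ₜ ∑ₛ k(yₜ, zₛ)`, with `t, s` ranging over the first `M`
indices. -/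
def centredSum (y z : ℕ → 𝕏) (M : ℕ) : ℝ :=
  1 / ((M : ℝ) - 1) * ∑ t ∈ Finset.range M, k (y t) (z t) -
    1 / (((M : ℝ) - 1) * M) * ∑ t ∈ Finset.range M, ∑ s ∈ Finset.range M, k (y t) (z s)

/-- The estimator of the kernel covariance from the first `M` of the `2 × 2` samples `x t`
(`x t i j` is observation `j` of group `i` in sample `t`). -/
def covEstimator (x : ℕ → Fin 2 → Fin 2 → 𝕏) (M : ℕ) : ℝ :=
  centredSum k (fun t => x t 0 0) (fun t => x t 1 0) M

/-- The estimator of the kernel variance of group `i` from the first `M` samples. -/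
def varEstimator (i : Fin 2) (x : ℕ → Fin 2 → Fin 2 → 𝕏) (M : ℕ) : ℝ :=
  centredSum k (fun t => x t i 0) (fun t => x t i 1) M

/-- The plug-in estimator of the kernel correlation from the first `M` samples. -/
def corrEstimator (x : ℕ → Fin 2 → Fin 2 → 𝕏) (M : ℕ) : ℝ :=
  covEstimator k x M / (√(varEstimator k 0 x M) * √(varEstimator k 1 x M))

end Estimators

end KernelCorr

end

/-! Write φ(x) = k(x, ·). Every estimator here is an empirical cross-covariance of features, so it
does not change when φ is replaced by φ - m, with m the mean embedding of the group concerned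
(`BddKernel.centredSum_eq`). After centring, the double sum is an inner product ⟨U, V⟩ of two sums
of n independent mean-zero elements of ℍ_k. Their squared norms have expectation O(n), so ⟨U, V⟩ /
((n - 1) n) is O(1/n) in L¹ and disappears at scale √n. Up to the factor n / (n - 1), what remains
is the average of the i.i.d. bounded variables ⟨φ(y_t) - m, φ(z_t) - m'⟩. Their expectation is the
kernel covariance, because the two observations of a pair are conditionally independent
(`IsPartiallyExchangeableSample.integral_centred`).

The vector of covariance and variance estimators is therefore asymptotically linear
(`BddKernel.tendsto_lintegral_centredSum_sub`). The correlation is a function g of this vector,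
differentiable at the true value because both variances are positive there, so the delta method
(`tendstoInDistribution_of_asymptotically_linear`) concludes. The derivative g' is applied before
passing to the limit, so a scalar central limit theorem for g'(Z_t) suffices. -/

noncomputable section

namespace KernelCorr

/-! ### Delta method for asymptotically linear estimators -/

section DeltaMethod

variable {Ω : Type*} [MeasurableSpace Ω] {ν : Measure Ω}

/-- A sequence that is bounded in `L¹` after rescaling by `r n → ∞` has a remainder in the first
order Taylor expansion that is negligible in probability at the scale `r n`. -/
lemma tendstoInMeasure_taylor_remainder {E : Type*} [NormedAddCommGroup E] [NormedSpace ℝ E]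
    [MeasurableSpace E] [BorelSpace E] [MeasurableSub₂ E]
    {T : ℕ → Ω → E} (hT : ∀ n, Measurable (T n)) {θ : E} {g : E → ℝ} {g' : E →L[ℝ] ℝ}
    (hg : HasFDerivAt g g' θ) {r : ℕ → ℝ} (hr : Tendsto r atTop atTop) {K : ENNReal}
    (hK : K ≠ ⊤) (hbd : ∀ᶠ n in atTop, ∫⁻ ω, ‖r n * ‖T n ω - θ‖‖ₑ ∂ν ≤ K) :
    TendstoInMeasure ν (fun n ω => r n * (g (T n ω) - g θ - g' (T n ω - θ))) atTop 0 := by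
  rw [tendstoInMeasure_iff_norm]
  intro ε hε
  rw [ENNReal.tendsto_nhds_zero]
  intro η hη
  obtain rfl | hη_top := eq_or_ne η ⊤
  · exact Eventually.of_forall fun _ => le_top
  lift K to NNReal using hK
  lift η to NNReal using hη_top
  have hη' : (0 : ℝ) < η := by exact_mod_cast hη
  -- c is the slope allowed for the Taylor remainder: Markov's inequality at level ε / c then costs
  -- at most η / 2. The `K + 1` in the witness covers K = 0.
  obtain ⟨c, hc, hcK⟩ : ∃ c : ℝ, 0 < c ∧ c * K ≤ ε * (η / 2) := by
    refine ⟨ε * (η / 2) / (K + 1), by positivity, ?_⟩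
    rw [div_mul_eq_mul_div, div_le_iff₀ (by positivity)]
    have : (0 : ℝ) ≤ ε * (η / 2) := by positivity
    nlinarith [K.2]
  obtain ⟨δ, hδ, hball⟩ := Metric.eventually_nhds_iff.mp
    ((hasFDerivAt_iff_isLittleO.mp hg).def hc)
  -- The threshold 2K / (δη) makes Markov's inequality bound the probability of leaving the δ-ball
  -- by η / 2.
  filter_upwards [hbd, hr.eventually_ge_atTop (2 * K / (δ * η)), hr.eventually_gt_atTop 0]
    with n hn hrn hr0
  have hmeas : Measurable fun ω => ‖r n * ‖T n ω - θ‖‖ₑ := by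
    have := (hT n).sub_const θ
    fun_prop
  have markov (a b : ℝ) (ha : 0 < a) (hab : (K : ℝ) ≤ a * b) :
      ν {ω | a ≤ r n * ‖T n ω - θ‖} ≤ ENNReal.ofReal b := by
    have h1 := meas_ge_le_lintegral_div (μ := ν) hmeas.aemeasurable
      (ε := ENNReal.ofReal a) (by simpa using ha) ENNReal.ofReal_ne_top
    have hset : {ω | a ≤ r n * ‖T n ω - θ‖} ⊆
        {ω | ENNReal.ofReal a ≤ ‖r n * ‖T n ω - θ‖‖ₑ} := fun ω hω => by
      simp only [Set.mem_ofPred_eq] at hω ⊢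
      rw [← ofReal_norm]
      exact ENNReal.ofReal_le_ofReal (hω.trans (le_abs_self _))
    refine (measure_mono hset).trans (h1.trans ?_)
    refine (ENNReal.div_le_div_right hn _).trans ?_
    refine ENNReal.div_le_of_le_mul ?_
    rw [← ENNReal.ofReal_mul' ha.le, ← ENNReal.ofReal_coe_nnreal]
    exact ENNReal.ofReal_le_ofReal (by linarith)
  -- Inside the δ-ball the remainder is at most c‖T - θ‖; if moreover r‖T - θ‖ < ε / c, the rescaled
  -- remainder is below ε.
  have hsub : {ω | ε ≤ ‖r n * (g (T n ω) - g θ - g' (T n ω - θ)) - (0 : ℕ → Ω → ℝ) n ω‖} ⊆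
      {ω | δ * r n ≤ r n * ‖T n ω - θ‖} ∪ {ω | ε / c ≤ r n * ‖T n ω - θ‖} := by
    intro ω hω
    by_contra hcon
    simp only [Set.mem_union, Set.mem_ofPred_eq, not_or, not_le] at hcon hω
    have h1 : ‖T n ω - θ‖ < δ := by
      exact lt_of_mul_lt_mul_left (hcon.1.trans_eq (mul_comm _ _)) hr0.le
    have h2 := hball (y := T n ω) (by rwa [dist_eq_norm])
    rw [lt_div_iff₀ hc] at hcon
    simp only [Pi.zero_apply, sub_zero, norm_mul, Real.norm_of_nonneg hr0.le] at hω
    have h3 := mul_le_mul_of_nonneg_left h2 hr0.le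
    linarith [hcon.2]
  calc _ ≤ _ := measure_mono hsub
    _ ≤ ENNReal.ofReal (η / 2) + ENNReal.ofReal (η / 2) := by
      refine (measure_union_le _ _).trans (add_le_add (markov _ _ (by positivity) ?_)
        (markov _ _ (by positivity) ?_))
      · rw [div_le_iff₀ (by positivity)] at hrn
        linarith
      · rw [div_mul_eq_mul_div, le_div_iff₀ hc]
        linarith
    _ = η := by
      rw [← ENNReal.ofReal_add (by positivity) (by positivity), add_halves,
        ENNReal.ofReal_coe_nnreal]

variable [IsProbabilityMeasure ν]

/-- Normalized sums of independent, identically distributed square integrable variables are bounded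
in `L¹`. -/
lemma lintegral_enorm_normalized_sum_le {Z : ℕ → Ω → ℝ} (hZ : MemLp (Z 0) 2 ν)
    (hindep : iIndepFun Z ν) (hident : ∀ t, IdentDistrib (Z t) (Z 0) ν ν) (n : ℕ) :
    ∫⁻ ω, ‖(√(n : ℝ))⁻¹ * ∑ t ∈ Finset.range n, (Z t ω - ∫ ω', Z 0 ω' ∂ν)‖ₑ ∂ν ≤
      1 + ENNReal.ofReal Var[Z 0; ν] := by
  have hZt (t : ℕ) : MemLp (Z t) 2 ν := (hident t).memLp_iff.2 hZ
  -- Reduces the L¹ bound to the second moment, which is a variance and hence additive over the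
  -- independent summands.
  have hle (x : ℝ) : ‖x‖ₑ ≤ 1 + ‖x‖ₑ ^ 2 := by
    rw [← ofReal_norm, ← ENNReal.ofReal_one, ← ENNReal.ofReal_pow (norm_nonneg _),
      ← ENNReal.ofReal_add zero_le_one (by positivity)]
    exact ENNReal.ofReal_le_ofReal (by nlinarith [sq_nonneg (‖x‖ - 1)])
  refine (lintegral_mono fun ω => hle _).trans ?_
  rw [lintegral_add_left measurable_const, lintegral_const, measure_univ, mul_one]
  refine add_le_add le_rfl ?_
  set S : Ω → ℝ := ∑ t ∈ Finset.range n, Z t with hS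
  have hSL : MemLp S 2 ν := memLp_finsetSum' _ fun t _ => hZt t
  have hES : ∫ ω, S ω ∂ν = n * ∫ ω, Z 0 ω ∂ν := by
    simp only [hS, Finset.sum_apply]
    rw [integral_finsetSum _ fun t _ => (hZt t).integrable (by norm_num)]
    simp [fun t => (hident t).integral_eq]
  have hvar : Var[S; ν] = n * Var[Z 0; ν] := by
    rw [hS, IndepFun.variance_sum (fun t _ => hZt t) fun i _ j _ hij => hindep.indepFun hij]
    simp [fun t => (hident t).variance_eq]
  have hpt (ω : Ω) : ‖(√(n : ℝ))⁻¹ * ∑ t ∈ Finset.range n, (Z t ω - ∫ ω', Z 0 ω' ∂ν)‖ₑ ^ 2 =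
      ENNReal.ofReal (n : ℝ)⁻¹ * ‖S ω - ∫ ω', S ω' ∂ν‖ₑ ^ 2 := by
    rw [hES, enorm_mul, mul_pow, Finset.sum_sub_distrib, hS]
    congr 1
    · rw [← ofReal_norm, ← ENNReal.ofReal_pow (norm_nonneg _)]
      simp [Real.sq_sqrt]
    · simp
  simp_rw [hpt]
  rw [lintegral_const_mul' _ _ ENNReal.ofReal_ne_top]
  change _ * eVar[S; ν] ≤ _
  rw [← ofReal_variance hSL, hvar, ← ENNReal.ofReal_mul (by positivity)]
  refine ENNReal.ofReal_le_ofReal ?_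
  rw [← mul_assoc]
  refine mul_le_of_le_one_left (variance_nonneg _ _) ?_
  rcases n.eq_zero_or_pos with rfl | hn
  · simp
  · rw [inv_mul_cancel₀ (by positivity)]

/-- The **delta method** for estimators that agree, up to an `L¹`-negligible error, with the mean of
independent, identically distributed square integrable vectors. -/
theorem tendstoInDistribution_of_asymptotically_linear {ι : Type*} [Fintype ι]
    {T Z : ℕ → Ω → ι → ℝ} {θ : ι → ℝ} (hT : ∀ n, Measurable (T n))
    (hZ : ∀ i, MemLp (fun ω => Z 0 ω i) 2 ν) (hmean : ∀ i, ∫ ω, Z 0 ω i ∂ν = θ i)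
    (hindep : iIndepFun Z ν) (hident : ∀ t, IdentDistrib (Z t) (Z 0) ν ν)
    (hlin : ∀ i, Tendsto (fun n : ℕ => ∫⁻ ω, ‖√(n : ℝ) * (T n ω i - θ i) -
      (√(n : ℝ))⁻¹ * ∑ t ∈ Finset.range n, (Z t ω i - θ i)‖ₑ ∂ν) atTop (𝓝 0))
    {g : (ι → ℝ) → ℝ} {g' : (ι → ℝ) →L[ℝ] ℝ} (hgm : Measurable g) (hg : HasFDerivAt g g' θ) :
    ∃ v : NNReal, TendstoInDistribution (fun (n : ℕ) ω => √(n : ℝ) * (g (T n ω) - g θ))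
      atTop (id : ℝ → ℝ) (fun _ => ν) (gaussianReal 0 v) := by
  have hZm (t : ℕ) : AEMeasurable (Z t) ν := (hident t).aemeasurable_fst
  have hsqrt : Tendsto (fun n : ℕ => √(n : ℝ)) atTop atTop :=
    Real.tendsto_sqrt_atTop.comp tendsto_natCast_atTop_atTop
  set ρ : ℕ → Ω → ι → ℝ := fun n ω i => √(n : ℝ) * (T n ω i - θ i) -
      (√(n : ℝ))⁻¹ * ∑ t ∈ Finset.range n, (Z t ω i - θ i) with hρ
  have hρm (n : ℕ) : AEMeasurable (ρ n) ν := by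
    have := hT n
    refine aemeasurable_pi_lambda _ fun i => ?_
    simp only [hρ]
    have h1 (t : ℕ) : AEMeasurable (fun ω => Z t ω i) ν :=
      (measurable_pi_apply i).comp_aemeasurable (hZm t)
    fun_prop
  have hnorm (x : ι → ℝ) : ‖x‖ₑ ≤ ∑ i, ‖x i‖ₑ := by
    simp only [enorm]
    rw [← ENNReal.ofNNReal_finsetSum, ENNReal.coe_le_coe]
    exact pi_nnnorm_le_iff.mpr fun i =>
      Finset.single_le_sum (f := fun i => ‖x i‖₊) (fun _ _ => zero_le) (Finset.mem_univ i)
  have hρlim : Tendsto (fun n => ∫⁻ ω, ‖ρ n ω‖ₑ ∂ν) atTop (𝓝 0) := by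
    have h0 := tendsto_finsetSum Finset.univ fun i _ => hlin i
    rw [Finset.sum_const_zero] at h0
    refine tendsto_of_tendsto_of_tendsto_of_le_of_le tendsto_const_nhds h0 (fun _ => zero_le)
      fun n => (lintegral_mono fun ω => hnorm _).trans_eq ?_
    refine lintegral_finsetSum' _ fun i _ => ?_
    exact ((measurable_pi_apply i).comp_aemeasurable (hρm n)).enorm
  set L : ℕ → Ω → ℝ := fun t ω => g' (Z t ω) with hL
  have hLident (t : ℕ) : IdentDistrib (L t) (L 0) ν ν := (hident t).comp g'.measurable
  have hLindep : iIndepFun L ν := hindep.comp (fun _ => g') fun _ => g'.measurable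
  have hZ0 : MemLp (Z 0) 2 ν := MemLp.of_eval hZ
  have hL0 : MemLp (L 0) 2 ν := g'.comp_memLp' hZ0
  have hLmean : ∫ ω, L 0 ω ∂ν = g' θ := by
    rw [hL, ContinuousLinearMap.integral_comp_comm _ (hZ0.integrable (by norm_num))]
    congr 1
    ext i
    rw [eval_integral fun i => (hZ i).integrable (by norm_num), hmean]
  have hclt := tendstoInDistribution_inv_sqrt_mul_sum_sub
    (P' := gaussianReal 0 Var[L 0; ν].toNNReal) HasLaw.id hL0 hLindep hLident
  refine ⟨Var[L 0; ν].toNNReal, ?_⟩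
  rw [hLmean] at hclt
  have hLm (t : ℕ) : AEMeasurable (L t) ν := (hLident t).aemeasurable_fst
  -- By linearity, g' of the vector error is the error of the scalar approximation, so it is
  -- L¹-negligible as well.
  have hgρ (n : ℕ) (ω : Ω) : g' (ρ n ω) = √(n : ℝ) * g' (T n ω - θ) -
      (√(n : ℝ))⁻¹ * (∑ t ∈ Finset.range n, L t ω - n * g' θ) := by
    have : ρ n ω = √(n : ℝ) • (T n ω - θ) -
        (√(n : ℝ))⁻¹ • (∑ t ∈ Finset.range n, Z t ω - (n : ℝ) • θ) := by
      ext i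
      simp [hρ]
    rw [this]
    simp [hL]
  -- Slutsky is used twice: here from the normalized sum of the L t to √n g'(T - θ), then from there
  -- to √n (g(T) - g(θ)).
  have hlinear := tendstoInDistribution_of_tendstoInMeasure_sub
    (fun (n : ℕ) ω => √(n : ℝ) * g' (T n ω - θ)) _ hclt ?_ ?_
  refine tendstoInDistribution_of_tendstoInMeasure_sub _ _ hlinear ?_ ?_
  · convert! tendstoInMeasure_taylor_remainder hT hg hsqrt
      -- The leading 1 eventually bounds the L¹ norm of ρ; the sum bounds the normalized sums
      -- coordinate by coordinate.
      (K := 1 + ∑ i, (1 + ENNReal.ofReal Var[fun ω => Z 0 ω i; ν])) ?_ ?_ using 3 with n ω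
    · simp
      ring
    · simp [ENNReal.sum_eq_top]
    · filter_upwards [hρlim.eventually_le_const (zero_lt_one)] with n hn
      have hpt (ω : Ω) : ‖√(n : ℝ) * ‖T n ω - θ‖‖ₑ ≤ ‖ρ n ω‖ₑ +
          ∑ i, ‖(√(n : ℝ))⁻¹ * ∑ t ∈ Finset.range n, (Z t ω i - θ i)‖ₑ := by
        have h1 : ‖√(n : ℝ) * ‖T n ω - θ‖‖ₑ = ‖√(n : ℝ) • (T n ω - θ)‖ₑ := by
          rw [enorm_mul, enorm_norm, enorm_smul]
        have h2 : √(n : ℝ) • (T n ω - θ) = ρ n ω +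
            fun i => (√(n : ℝ))⁻¹ * ∑ t ∈ Finset.range n, (Z t ω i - θ i) := by
          ext i
          simp [hρ]
        rw [h1, h2]
        exact (enorm_add_le _ _).trans (add_le_add le_rfl (hnorm _))
      refine (lintegral_mono hpt).trans ?_
      rw [lintegral_add_left' (hρm n).enorm]
      refine add_le_add hn ?_
      have hZi (i : ι) (t : ℕ) : AEMeasurable (fun ω => Z t ω i) ν :=
        (measurable_pi_apply i).comp_aemeasurable (hZm t)
      rw [lintegral_finsetSum' _ fun i _ => by have := hZi i; fun_prop]
      refine Finset.sum_le_sum fun i _ => ?_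
      have := lintegral_enorm_normalized_sum_le (Z := fun t ω => Z t ω i) (hZ i)
        (hindep.comp (fun _ x => x i) fun _ => measurable_pi_apply i)
        (fun t => (hident t).comp (measurable_pi_apply i)) n
      rwa [hmean] at this
  · intro n
    have := hT n
    fun_prop
  · refine tendstoInMeasure_of_tendsto_eLpNorm one_ne_zero (fun n => ?_) (by fun_prop) ?_
    · have := hT n
      refine AEMeasurable.aestronglyMeasurable (AEMeasurable.sub ?_ ?_) <;> fun_prop
    · simp only [eLpNorm_one_eq_lintegral_enorm]
      have h0 := ENNReal.Tendsto.const_mul (a := ‖g'‖ₑ) hρlim (Or.inr enorm_ne_top)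
      rw [mul_zero] at h0
      refine tendsto_of_tendsto_of_tendsto_of_le_of_le tendsto_const_nhds h0 (fun _ => zero_le)
        fun n => ?_
      rw [← lintegral_const_mul' _ _ enorm_ne_top]
      refine lintegral_mono fun ω => ?_
      simp only [Pi.sub_apply, Pi.zero_apply, sub_zero, ← hgρ]
      exact g'.le_opENorm _
  · intro n
    have := hT n
    exact AEMeasurable.const_mul (by fun_prop) _

end DeltaMethod

/-! ### Centred features and degeneracy of the double sum -/

namespace BddKernel

variable {𝕏 : Type*} [MeasurableSpace 𝕏] (k : BddKernel 𝕏)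

/-- The canonical feature map `x ↦ k(x, ·)`. -/
def feature (x : 𝕏) : k.Space := RKHS.kerFun k.Space x 1

lemma inner_feature (f : k.Space) (x : 𝕏) : inner ℝ f (k.feature x) = f x := by
  rw [feature, RKHS.inner_kerFun]
  simp

lemma feature_apply (x y : 𝕏) : k.feature x y = k x y := by
  rw [feature, RKHS.kerFun_apply, RKHS.OfKernel.kernel_ofKernel]
  simp [matrix, k.symm]

lemma norm_feature_le {C : ℝ} (hC : ∀ x y, |k x y| ≤ C) (x : 𝕏) : ‖k.feature x‖ ≤ √C := by
  refine Real.le_sqrt_of_sq_le ?_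
  rw [← real_inner_self_eq_norm_sq, inner_feature, feature_apply]
  exact (le_abs_self _).trans (hC x x)

/-- The kernel `⟨k(y, ·) - m, k(z, ·) - m'⟩` centred at `m` and `m'`. -/
def centred (m m' : k.Space) (y z : 𝕏) : ℝ := inner ℝ (k.feature y - m) (k.feature z - m')

lemma centred_eq (m m' : k.Space) (y z : 𝕏) :
    k.centred m m' y z = k y z - m' y - m z + inner ℝ m m' := by
  simp only [centred, inner_sub_left, inner_sub_right, inner_feature, feature_apply]
  rw [real_inner_comm, inner_feature]
  ring

/-- For fixed y this exhibits the centred kernel as an element of ℍ_k evaluated at z, minus a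
constant, so the weak characterization of means applies to its z-integral. -/
lemma centred_eq_coe (m m' : k.Space) (y z : 𝕏) :
    k.centred m m' y z = (k.feature y - m) z - inner ℝ (k.feature y - m) m' := by
  rw [centred, inner_sub_right, inner_feature]

/-- The scalar expansion gives measurability without any measurability or separability of the
feature map into ℍ_k. -/
lemma measurable_centred (m m' : k.Space) :
    Measurable (Function.uncurry (k.centred m m')) := by
  have h := k.measurable
  have hm := k.measurable_coe m
  have hm' := k.measurable_coe m'
  have : Function.uncurry (k.centred m m') =
      fun p => Function.uncurry k.toFun p - m' p.1 - m p.2 + inner ℝ m m' := by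
    ext p
    exact k.centred_eq m m' p.1 p.2
  rw [this]
  fun_prop

lemma exists_abs_centred_le (m m' : k.Space) :
    ∃ B : ℝ, 0 ≤ B ∧ ∀ y z, |k.centred m m' y z| ≤ B := by
  obtain ⟨C, hC⟩ := k.bounded
  have h (m : k.Space) (y : 𝕏) : ‖k.feature y - m‖ ≤ √C + ‖m‖ :=
    (norm_sub_le _ _).trans (add_le_add (k.norm_feature_le hC y) le_rfl)
  refine ⟨(√C + ‖m‖) * (√C + ‖m'‖), by positivity, fun y z => ?_⟩
  refine (abs_real_inner_le_norm _ _).trans ?_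
  exact mul_le_mul (h m y) (h m' z) (norm_nonneg _) (by positivity)

lemma integral_centred_right {p : Measure 𝕏} [IsProbabilityMeasure p] (m m' : k.Space) (y : 𝕏) :
    ∫ z, k.centred m m' y z ∂p =
      ∫ z, (k.feature y - m) z ∂p - inner ℝ (k.feature y - m) m' := by
  simp only [centred_eq_coe]
  rw [integral_sub (k.integrable_coe p _) (integrable_const _)]
  simp

/-- Integrating the centred kernel gives the inner product of the centred mean embeddings. -/
lemma inner_meanEmbedding_sub (p q : ProbabilityMeasure 𝕏) (m m' : k.Space) :
    inner ℝ (k.meanEmbedding p - m) (k.meanEmbedding q - m') =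
      ∫ y, ∫ z, k.centred m m' y z ∂(q : Measure 𝕏) ∂(p : Measure 𝕏) := by
  have h1 (y : 𝕏) : ∫ z, k.centred m m' y z ∂(q : Measure 𝕏) =
      (k.meanEmbedding q - m') y - inner ℝ m (k.meanEmbedding q - m') := by
    rw [integral_centred_right, ← inner_meanEmbedding, real_inner_comm, ← inner_sub_right,
      inner_sub_left, real_inner_comm, inner_feature]
  simp_rw [h1]
  rw [integral_sub (k.integrable_coe _ _) (integrable_const _), ← inner_meanEmbedding,
    inner_sub_left]
  simp

variable {Ω : Type*} [MeasurableSpace Ω] {ν : Measure Ω} [IsProbabilityMeasure ν]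

/-- By Fubini it is enough that the inner integral over Y' vanishes for each fixed y. Only m' has to
be a mean; m is arbitrary. -/
lemma integral_centred_of_indepFun {Y Y' : Ω → 𝕏} (hY : Measurable Y) (hY' : Measurable Y')
    (h : IndepFun Y Y' ν) (m : k.Space) {m' : k.Space}
    (hm' : ∀ f : k.Space, inner ℝ f m' = ∫ ω, f (Y' ω) ∂ν) :
    ∫ ω, k.centred m m' (Y ω) (Y' ω) ∂ν = 0 := by
  have : IsProbabilityMeasure (ν.map Y) := Measure.isProbabilityMeasure_map hY.aemeasurable
  have : IsProbabilityMeasure (ν.map Y') := Measure.isProbabilityMeasure_map hY'.aemeasurable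
  obtain ⟨B, -, hB⟩ := k.exists_abs_centred_le m m'
  have hmeas := k.measurable_centred m m'
  have h1 := integral_map (μ := ν) (hY.prodMk hY').aemeasurable
    (f := Function.uncurry (k.centred m m')) hmeas.aestronglyMeasurable
  simp only [Function.uncurry_apply_pair] at h1
  rw [← h1, (indepFun_iff_map_prod_eq_prod_map_map hY.aemeasurable hY'.aemeasurable).mp h,
    integral_prod _ (Integrable.of_bound hmeas.aestronglyMeasurable B
      (Eventually.of_forall fun p => hB p.1 p.2))]
  simp only [Function.uncurry_apply_pair]
  refine integral_eq_zero_of_ae (Eventually.of_forall fun y => ?_)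
  simp only [Pi.zero_apply]
  rw [integral_centred_right, hm',
    integral_map hY'.aemeasurable (k.measurable_coe _).aestronglyMeasurable, sub_self]

/-- The square norm of a sum of `n` independent centred features has mean of order `n`. -/
lemma integral_norm_sq_sum_feature_sub_le {Y : ℕ → Ω → 𝕏} (hY : ∀ t, Measurable (Y t))
    (hindep : Pairwise fun t s => IndepFun (Y t) (Y s) ν) {m : k.Space}
    (hm : ∀ t, ∀ f : k.Space, inner ℝ f m = ∫ ω, f (Y t ω) ∂ν) :
    ∃ B : ℝ, 0 ≤ B ∧ ∀ n : ℕ,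
      Integrable (fun ω => ‖∑ t ∈ Finset.range n, (k.feature (Y t ω) - m)‖ ^ 2) ν ∧
      ∫ ω, ‖∑ t ∈ Finset.range n, (k.feature (Y t ω) - m)‖ ^ 2 ∂ν ≤ n * B := by
  obtain ⟨B, hB0, hB⟩ := k.exists_abs_centred_le m m
  refine ⟨B, hB0, fun n => ?_⟩
  have hexp (ω : Ω) : ‖∑ t ∈ Finset.range n, (k.feature (Y t ω) - m)‖ ^ 2 =
      ∑ t ∈ Finset.range n, ∑ s ∈ Finset.range n, k.centred m m (Y t ω) (Y s ω) := by
    rw [← real_inner_self_eq_norm_sq, sum_inner]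
    simp only [inner_sum, centred]
  have hint (t s : ℕ) : Integrable (fun ω => k.centred m m (Y t ω) (Y s ω)) ν :=
    Integrable.of_bound ((k.measurable_centred m m).comp
      ((hY t).prodMk (hY s))).aestronglyMeasurable B (Eventually.of_forall fun ω => hB _ _)
  have hsum (t : ℕ) : ∫ ω, ∑ s ∈ Finset.range n, k.centred m m (Y t ω) (Y s ω) ∂ν ≤ B := by
    rw [integral_finsetSum _ fun s _ => hint t s]
    -- Off-diagonal terms vanish by independence, so only n of the n² terms survive.
    have hle (s : ℕ) : ∫ ω, k.centred m m (Y t ω) (Y s ω) ∂ν ≤ if s = t then B else 0 := by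
      split_ifs with h
      · refine (integral_mono (hint t s) (integrable_const B) fun ω =>
          (le_abs_self _).trans (hB _ _)).trans_eq ?_
        simp
      · exact (k.integral_centred_of_indepFun (hY t) (hY s) (hindep (Ne.symm h)) m (hm s)).le
    refine (Finset.sum_le_sum fun s _ => hle s).trans ?_
    rw [Finset.sum_ite_eq']
    split_ifs <;> simp [hB0]
  simp only [hexp]
  refine ⟨integrable_finsetSum _ fun t _ => integrable_finsetSum _ fun s _ => hint t s, ?_⟩
  rw [integral_finsetSum _ fun t _ => integrable_finsetSum _ fun s _ => hint t s]
  refine (Finset.sum_le_sum fun t _ => hsum t).trans_eq ?_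
  simp

/-- `centredSum` is unchanged when the features are centred. -/
lemma centredSum_eq (m m' : k.Space) (y z : ℕ → 𝕏) (n : ℕ) :
    centredSum k y z n = 1 / ((n : ℝ) - 1) * ∑ t ∈ Finset.range n, k.centred m m' (y t) (z t) -
      1 / (((n : ℝ) - 1) * n) * inner ℝ (∑ t ∈ Finset.range n, (k.feature (y t) - m))
        (∑ s ∈ Finset.range n, (k.feature (z s) - m')) := by
  rcases n.eq_zero_or_pos with rfl | hn
  · simp [centredSum]
  have hinner : inner ℝ (∑ t ∈ Finset.range n, (k.feature (y t) - m))
        (∑ s ∈ Finset.range n, (k.feature (z s) - m')) =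
      ∑ t ∈ Finset.range n, ∑ s ∈ Finset.range n, k.centred m m' (y t) (z s) := by
    rw [sum_inner]
    simp only [inner_sum, centred]
  rw [hinner, centredSum]
  simp only [centred_eq, Finset.sum_add_distrib, Finset.sum_sub_distrib, Finset.sum_const,
    Finset.card_range, nsmul_eq_mul, ← Finset.mul_sum]
  -- Terms depending on at most one of y and z cancel between the single and the double sum. The
  -- factor (n - 1)⁻¹ is common to both, so n = 1, where it is 0, needs no separate case.
  have hn' : (n : ℝ) ≠ 0 := by positivity
  rw [one_div, one_div, mul_inv]
  field_simp
  ring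

/-- The centred sum differs from the mean of the centred kernel over the sample by an
`L¹`-negligible term. -/
lemma tendsto_lintegral_centredSum_sub {Y Z : ℕ → Ω → 𝕏} (hY : ∀ t, Measurable (Y t))
    (hZ : ∀ t, Measurable (Z t)) (hYi : Pairwise fun t s => IndepFun (Y t) (Y s) ν)
    (hZi : Pairwise fun t s => IndepFun (Z t) (Z s) ν) {m m' : k.Space}
    (hm : ∀ t, ∀ f : k.Space, inner ℝ f m = ∫ ω, f (Y t ω) ∂ν)
    (hm' : ∀ t, ∀ f : k.Space, inner ℝ f m' = ∫ ω, f (Z t ω) ∂ν) (c : ℝ) :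
    Tendsto (fun n : ℕ => ∫⁻ ω, ‖√(n : ℝ) *
        (centredSum k (fun t => Y t ω) (fun t => Z t ω) n - c) -
      (√(n : ℝ))⁻¹ * ∑ t ∈ Finset.range n, (k.centred m m' (Y t ω) (Z t ω) - c)‖ₑ ∂ν)
      atTop (𝓝 0) := by
  obtain ⟨B, hB0, hB⟩ := k.exists_abs_centred_le m m'
  obtain ⟨B₁, hB₁0, hB₁⟩ := k.integral_norm_sq_sum_feature_sub_le hY hYi hm
  obtain ⟨B₂, hB₂0, hB₂⟩ := k.integral_norm_sq_sum_feature_sub_le hZ hZi hm'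
  have hlim : Tendsto (fun n : ℕ => ENNReal.ofReal ((√(n : ℝ))⁻¹ * (2 * (B + B₁ + B₂))))
      atTop (𝓝 0) := by
    rw [← ENNReal.ofReal_zero, ← zero_mul (2 * (B + B₁ + B₂))]
    exact ENNReal.tendsto_ofReal ((tendsto_inv_atTop_zero.comp
      (Real.tendsto_sqrt_atTop.comp tendsto_natCast_atTop_atTop)).mul_const _)
  refine tendsto_of_tendsto_of_tendsto_of_le_of_le' tendsto_const_nhds hlim
    (Eventually.of_forall fun _ => zero_le) ?_
  filter_upwards [eventually_ge_atTop 2] with n hn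
  have hn2 : (2 : ℝ) ≤ n := by exact_mod_cast hn
  set U : Ω → k.Space := fun ω => ∑ t ∈ Finset.range n, (k.feature (Y t ω) - m)
  set V : Ω → k.Space := fun ω => ∑ t ∈ Finset.range n, (k.feature (Z t ω) - m')
  have hs : 0 < √(n : ℝ) := by positivity
  set a : ℝ := (√(n : ℝ))⁻¹ * ((n : ℝ) - 1)⁻¹ with ha
  have ha0 : 0 ≤ a := by
    have : (0 : ℝ) ≤ n - 1 := by linarith
    positivity
  have hpt (ω : Ω) : ‖√(n : ℝ) * (centredSum k (fun t => Y t ω) (fun t => Z t ω) n - c) -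
      (√(n : ℝ))⁻¹ * ∑ t ∈ Finset.range n, (k.centred m m' (Y t ω) (Z t ω) - c)‖ ≤
      a * (n * B + (‖U ω‖ ^ 2 + ‖V ω‖ ^ 2)) := by
    -- Both leftovers carry the same weight: √n / (n - 1) - 1 / √n = √n / ((n - 1) n) = a. The
    -- constant c cancels.
    have heq : √(n : ℝ) * (centredSum k (fun t => Y t ω) (fun t => Z t ω) n - c) -
        (√(n : ℝ))⁻¹ * ∑ t ∈ Finset.range n, (k.centred m m' (Y t ω) (Z t ω) - c) =
        a * (∑ t ∈ Finset.range n, k.centred m m' (Y t ω) (Z t ω) - inner ℝ (U ω) (V ω)) := by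
      have hsum : ∑ t ∈ Finset.range n, (k.centred m m' (Y t ω) (Z t ω) - c) =
          ∑ t ∈ Finset.range n, k.centred m m' (Y t ω) (Z t ω) - n * c := by
        simp [Finset.sum_sub_distrib]
      have hcs : centredSum k (fun t => Y t ω) (fun t => Z t ω) n =
          1 / ((n : ℝ) - 1) * ∑ t ∈ Finset.range n, k.centred m m' (Y t ω) (Z t ω) -
            1 / (((n : ℝ) - 1) * n) * inner ℝ (U ω) (V ω) := k.centredSum_eq m m' _ _ n
      rw [hsum, hcs, ha]
      have hn1 : (n : ℝ) - 1 ≠ 0 := by linarith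
      obtain ⟨s, hs', hsn⟩ : ∃ s : ℝ, s ≠ 0 ∧ √(n : ℝ) = s := ⟨_, hs.ne', rfl⟩
      have hsq : (n : ℝ) = s ^ 2 := by rw [← hsn, Real.sq_sqrt (by positivity)]
      rw [hsn]
      rw [hsq] at hn1 ⊢
      field_simp
      ring
    rw [heq, norm_mul, Real.norm_of_nonneg ha0]
    refine mul_le_mul_of_nonneg_left ((norm_sub_le _ _).trans (add_le_add ?_ ?_)) ha0
    · refine (norm_sum_le _ _).trans ((Finset.sum_le_sum fun t _ => hB _ _).trans_eq ?_)
      simp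
    -- Bounding ⟨U, V⟩ by ‖U‖² + ‖V‖² avoids any assumption on the dependence between Y and Z.
    · refine (norm_inner_le_norm _ _).trans ?_
      nlinarith [sq_nonneg (‖U ω‖ - ‖V ω‖), sq_nonneg (‖U ω‖ + ‖V ω‖)]
  have hint : Integrable (fun ω => a * (n * B + (‖U ω‖ ^ 2 + ‖V ω‖ ^ 2))) ν :=
    ((integrable_const _).add ((hB₁ n).1.add (hB₂ n).1)).const_mul a
  calc _ ≤ ∫⁻ ω, ENNReal.ofReal (a * (n * B + (‖U ω‖ ^ 2 + ‖V ω‖ ^ 2))) ∂ν :=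
        lintegral_mono fun ω => by
          rw [← ofReal_norm]
          exact ENNReal.ofReal_le_ofReal (hpt ω)
    _ = ENNReal.ofReal (∫ ω, a * (n * B + (‖U ω‖ ^ 2 + ‖V ω‖ ^ 2)) ∂ν) :=
        (ofReal_integral_eq_lintegral_ofReal hint
          (Eventually.of_forall fun ω => by positivity)).symm
    _ ≤ _ := by
        refine ENNReal.ofReal_le_ofReal ?_
        have hadd : ∫ ω, (n * B + (‖U ω‖ ^ 2 + ‖V ω‖ ^ 2)) ∂ν =
            n * B + (∫ ω, ‖U ω‖ ^ 2 ∂ν + ∫ ω, ‖V ω‖ ^ 2 ∂ν) := by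
          rw [← integral_add (hB₁ n).1 (hB₂ n).1]
          refine (integral_add (integrable_const _) ((hB₁ n).1.add (hB₂ n).1)).trans ?_
          simp
        rw [integral_const_mul, hadd]
        have h1 := (hB₁ n).2
        have h2 := (hB₂ n).2
        -- Valid for n ≥ 2; this is the factor 2 in `hlim`.
        have hn1 : ((n : ℝ) - 1)⁻¹ * n ≤ 2 := by
          rw [inv_mul_le_iff₀ (by linarith)]
          linarith
        calc _ ≤ a * (n * (B + B₁ + B₂)) := by
              refine mul_le_mul_of_nonneg_left ?_ ha0
              linarith
          _ = (√(n : ℝ))⁻¹ * ((((n : ℝ) - 1)⁻¹ * n) * (B + B₁ + B₂)) := by rw [ha]; ring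
          _ ≤ _ := by gcongr

end BddKernel

/-! ### Expectations under the partially exchangeable model -/

section Mixture

variable {Ω Ω' 𝕏 : Type*} [MeasurableSpace Ω] [MeasurableSpace Ω'] [MeasurableSpace 𝕏]

/-- Expectations of a pair that is conditionally independent given the random probability measures
`P₁`, `P₂`, its conditional marginals. -/
lemma integral_pair_eq {μ : Measure Ω} [IsProbabilityMeasure μ] {ν : Measure Ω'}
    [IsProbabilityMeasure ν] {P₁ P₂ : Ω → ProbabilityMeasure 𝕏} (hP₁ : Measurable P₁)
    (hP₂ : Measurable P₂) {Y Z : Ω' → 𝕏} (hY : Measurable Y) (hZ : Measurable Z)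
    (hlaw : ∀ A B : Set 𝕏, MeasurableSet A → MeasurableSet B →
      ν {ω' | Y ω' ∈ A ∧ Z ω' ∈ B} = ∫⁻ ω, (P₁ ω : Measure 𝕏) A * (P₂ ω : Measure 𝕏) B ∂μ)
    {F : 𝕏 → 𝕏 → ℝ} (hF : Measurable (Function.uncurry F)) {C : ℝ} (hC : ∀ y z, |F y z| ≤ C) :
    ∫ ω', F (Y ω') (Z ω') ∂ν =
      ∫ ω, ∫ y, ∫ z, F y z ∂(P₂ ω : Measure 𝕏) ∂(P₁ ω : Measure 𝕏) ∂μ := by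
  let κ₁ : Kernel Ω 𝕏 := ⟨fun ω => (P₁ ω : Measure 𝕏), measurable_subtype_coe.comp hP₁⟩
  let κ₂ : Kernel Ω 𝕏 := ⟨fun ω => (P₂ ω : Measure 𝕏), measurable_subtype_coe.comp hP₂⟩
  have : IsMarkovKernel κ₁ := ⟨fun ω => inferInstanceAs (IsProbabilityMeasure (P₁ ω : Measure 𝕏))⟩
  have : IsMarkovKernel κ₂ := ⟨fun ω => inferInstanceAs (IsProbabilityMeasure (P₂ ω : Measure 𝕏))⟩
  have : IsProbabilityMeasure (ν.map fun ω' => (Y ω', Z ω')) :=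
    Measure.isProbabilityMeasure_map (hY.prodMk hZ).aemeasurable
  -- The law of the pair is the μ-mixture of the products P₁ ⊗ P₂; agreement on rectangles suffices.
  have hmap : ν.map (fun ω' => (Y ω', Z ω')) = ((κ₁ ×ₖ κ₂) ∘ₖ Kernel.const Unit μ) () := by
    refine Measure.ext_prod fun {A B} hA hB => ?_
    rw [Measure.map_apply (hY.prodMk hZ) (hA.prod hB), Kernel.comp_apply' _ _ _ (hA.prod hB)]
    simp only [Kernel.prod_apply_prod, Kernel.const_apply]
    exact hlaw A B hA hB
  have h1 := integral_map (μ := ν) (hY.prodMk hZ).aemeasurable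
    (f := Function.uncurry F) hF.aestronglyMeasurable
  simp only [Function.uncurry_apply_pair] at h1
  rw [← h1, hmap, Kernel.integral_comp (Integrable.of_bound hF.aestronglyMeasurable C
    (Eventually.of_forall fun p => hC p.1 p.2)), Kernel.const_apply]
  refine integral_congr_ae (Eventually.of_forall fun ω => ?_)
  simp only [Kernel.prod_apply]
  rw [integral_prod _ (Integrable.of_bound hF.aestronglyMeasurable C
    (Eventually.of_forall fun p => hC p.1 p.2))]
  rfl

variable (k : BddKernel 𝕏)

/-- The mean of the embedding of a random probability measure represents the expectation of an
observation drawn from it. -/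
lemma inner_mean_meanEmbedding {μ : Measure Ω} [IsProbabilityMeasure μ]
    {P : Ω → ProbabilityMeasure 𝕏} (hP : Measurable P) (f : k.Space) :
    inner ℝ f (mean μ fun ω => k.meanEmbedding (P ω)) =
      ∫ ω, ∫ x, f x ∂(P ω : Measure 𝕏) ∂μ := by
  rw [real_inner_comm, (isMean_meanEmbedding k μ hP f).2]
  simp only [k.inner_meanEmbedding]

namespace IsPartiallyExchangeableSample

variable {μ : Measure Ω} {P : Fin 2 → Ω → ProbabilityMeasure 𝕏} {ν : Measure Ω'}
  {X : Fin 2 → Fin 2 → Ω' → 𝕏}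

/-- Marginalize by putting `Set.univ` in the other two slots. The slots must differ, since an
observation is not conditionally independent of itself. -/
lemma law_pair (hX : IsPartiallyExchangeableSample μ P ν X) {i j i' j' : Fin 2}
    (hne : (i, j) ≠ (i', j')) (A B : Set 𝕏) (hA : MeasurableSet A) (hB : MeasurableSet B) :
    ν {ω' | X i j ω' ∈ A ∧ X i' j' ω' ∈ B} =
      ∫⁻ ω, (P i ω : Measure 𝕏) A * (P i' ω : Measure 𝕏) B ∂μ := by
  have h := hX.law
    (fun a b => if (a, b) = (i, j) then A else if (a, b) = (i', j') then B else Set.univ)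
    fun a b => by split_ifs <;> simp [hA, hB]
  convert! h using 2
  · ext ω'
    fin_cases i <;> fin_cases j <;> fin_cases i' <;> fin_cases j' <;>
      first | exact absurd rfl hne | simp [Fin.forall_fin_two, and_comm]
  · ext ω
    fin_cases i <;> fin_cases j <;> fin_cases i' <;> fin_cases j' <;>
      first | exact absurd rfl hne | simp [Fin.prod_univ_two, mul_comm]

lemma integral_pair [IsProbabilityMeasure μ] [IsProbabilityMeasure ν]
    (hX : IsPartiallyExchangeableSample μ P ν X) (hP : ∀ i, Measurable (P i)) {i j i' j' : Fin 2}
    (hne : (i, j) ≠ (i', j')) {F : 𝕏 → 𝕏 → ℝ} (hF : Measurable (Function.uncurry F)) {C : ℝ}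
    (hC : ∀ y z, |F y z| ≤ C) :
    ∫ ω', F (X i j ω') (X i' j' ω') ∂ν =
      ∫ ω, ∫ y, ∫ z, F y z ∂(P i' ω : Measure 𝕏) ∂(P i ω : Measure 𝕏) ∂μ :=
  integral_pair_eq (hP i) (hP i') (hX.measurable i j) (hX.measurable i' j') (hX.law_pair hne) hF hC

lemma inner_mean [IsProbabilityMeasure μ] [IsProbabilityMeasure ν]
    (hX : IsPartiallyExchangeableSample μ P ν X) (hP : ∀ i, Measurable (P i)) (i j : Fin 2)
    (f : k.Space) :
    inner ℝ f (mean μ fun ω => k.meanEmbedding (P i ω)) = ∫ ω', f (X i j ω') ∂ν := by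
  obtain ⟨C, hC⟩ := k.bounded
  -- The second observation is a dummy: `i + 1` is the other group, and F ignores its second
  -- argument.
  have h := hX.integral_pair hP (i := i) (j := j) (i' := i + 1) (j' := j) (by simp)
    (F := fun y _ => f y) ((k.measurable_coe f).comp measurable_fst)
    (fun y _ => k.norm_apply_le hC f y)
  rw [h, inner_mean_meanEmbedding k (hP i)]
  simp

/-- The kernel covariance is the expectation of the centred kernel over a pair of observations. -/
lemma integral_centred [IsProbabilityMeasure μ] [IsProbabilityMeasure ν]
    (hX : IsPartiallyExchangeableSample μ P ν X) (hP : ∀ i, Measurable (P i)) {i j i' j' : Fin 2}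
    (hne : (i, j) ≠ (i', j')) :
    ∫ ω', k.centred (mean μ fun ω => k.meanEmbedding (P i ω))
        (mean μ fun ω => k.meanEmbedding (P i' ω)) (X i j ω') (X i' j' ω') ∂ν =
      kernelCov k μ (P i) (P i') := by
  obtain ⟨B, -, hB⟩ := k.exists_abs_centred_le (mean μ fun ω => k.meanEmbedding (P i ω))
    (mean μ fun ω => k.meanEmbedding (P i' ω))
  rw [hX.integral_pair hP hne (k.measurable_centred _ _) hB, kernelCov]
  simp only [k.inner_meanEmbedding_sub]

/-- Two samples from the same model have the same joint law. -/
lemma identDistrib {X' : Fin 2 → Fin 2 → Ω' → 𝕏} [IsFiniteMeasure ν]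
    (hX : IsPartiallyExchangeableSample μ P ν X) (hX' : IsPartiallyExchangeableSample μ P ν X') :
    IdentDistrib (fun ω i j => X i j ω) (fun ω i j => X' i j ω) ν ν := by
  have hm := hX.measurable
  have hm' := hX'.measurable
  -- With a single product index, boxes form a generating π-system, and `law` fixes the measure of
  -- each box.
  have h : IdentDistrib (fun ω (p : Fin 2 × Fin 2) => X p.1 p.2 ω)
      (fun ω (p : Fin 2 × Fin 2) => X' p.1 p.2 ω) ν ν := by
    have h1 : Measurable fun ω (p : Fin 2 × Fin 2) => X p.1 p.2 ω := by fun_prop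
    have h2 : Measurable fun ω (p : Fin 2 × Fin 2) => X' p.1 p.2 ω := by fun_prop
    refine ⟨h1.aemeasurable, h2.aemeasurable, ?_⟩
    refine ext_of_generate_finite _ generateFrom_pi.symm isPiSystem_pi ?_ ?_
    · rintro _ ⟨A, hA, rfl⟩
      simp only [Set.mem_pi, Set.mem_univ, forall_true_left] at hA
      have hAm : MeasurableSet (Set.univ.pi A) := MeasurableSet.univ_pi hA
      rw [Measure.map_apply h1 hAm, Measure.map_apply h2 hAm]
      have e1 := hX.law (fun i j => A (i, j)) fun i j => hA (i, j)
      have e2 := hX'.law (fun i j => A (i, j)) fun i j => hA (i, j)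
      convert! e1.trans e2.symm using 2 <;>
      · ext ω
        simp [Set.mem_pi, Prod.forall]
    · rw [Measure.map_apply h1 .univ, Measure.map_apply h2 .univ]
      simp
  exact h.comp (u := fun w i j => w (i, j)) (by fun_prop)

end IsPartiallyExchangeableSample

lemma measurable_centredSum {y z : Ω' → ℕ → 𝕏} (hy : ∀ t, Measurable fun ω => y ω t)
    (hz : ∀ t, Measurable fun ω => z ω t) (n : ℕ) :
    Measurable fun ω => centredSum k (y ω) (z ω) n := by
  have h (t s : ℕ) : Measurable fun ω => k (y ω t) (z ω s) :=
    k.measurable.comp ((hy t).prodMk (hz s))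
  unfold centredSum
  fun_prop

/-- Asymptotic normality of smooth functions of the kernel covariance estimators based on the pairs
of observations `(a l, b l)`. -/
theorem exists_tendstoInDistribution_centredSum {ι : Type*} [Fintype ι] {μ : Measure Ω}
    [IsProbabilityMeasure μ] {P : Fin 2 → Ω → ProbabilityMeasure 𝕏} (hP : ∀ i, Measurable (P i))
    {ν : Measure Ω'} [IsProbabilityMeasure ν] {X : ℕ → Fin 2 → Fin 2 → Ω' → 𝕏}
    (hX : ∀ t, IsPartiallyExchangeableSample μ P ν (X t))
    (hindep : iIndepFun (fun (t : ℕ) (ω : Ω') (i j : Fin 2) => X t i j ω) ν)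
    {a b : ι → Fin 2 × Fin 2} (hab : ∀ l, a l ≠ b l) {g : (ι → ℝ) → ℝ} (hgm : Measurable g)
    (hg : DifferentiableAt ℝ g fun l => kernelCov k μ (P (a l).1) (P (b l).1)) :
    ∃ v : NNReal, TendstoInDistribution
      (fun (n : ℕ) (ω : Ω') => √(n : ℝ) *
        (g (fun l => centredSum k (fun t => X t (a l).1 (a l).2 ω)
          (fun t => X t (b l).1 (b l).2 ω) n) -
          g fun l => kernelCov k μ (P (a l).1) (P (b l).1)))
      atTop (id : ℝ → ℝ) (fun _ => ν) (gaussianReal 0 v) := by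
  set m : Fin 2 → k.Space := fun i => mean μ fun ω => k.meanEmbedding (P i ω)
  set H : (Fin 2 → Fin 2 → 𝕏) → ι → ℝ := fun w l =>
    k.centred (m (a l).1) (m (b l).1) (w (a l).1 (a l).2) (w (b l).1 (b l).2)
  have hXm (t : ℕ) (i j : Fin 2) : Measurable (X t i j) := (hX t).measurable i j
  have hXm' (t : ℕ) : Measurable fun ω i j => X t i j ω := by fun_prop
  have hHl (l : ι) : Measurable fun w => H w l :=
    (k.measurable_centred _ _).comp
      (f := fun w : Fin 2 → Fin 2 → 𝕏 => (w (a l).1 (a l).2, w (b l).1 (b l).2)) (by fun_prop)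
  have hH : Measurable H := measurable_pi_lambda _ hHl
  -- Independence is available across samples t only; within one sample the observations may be
  -- dependent through P.
  have hXi (i j : Fin 2) : Pairwise fun t s => IndepFun (X t i j) (X s i j) ν := fun t s hts =>
    (hindep.indepFun hts).comp (φ := fun w : Fin 2 → Fin 2 → 𝕏 => w i j)
      (ψ := fun w : Fin 2 → Fin 2 → 𝕏 => w i j) (by fun_prop) (by fun_prop)
  have hH2 (l : ι) : MemLp (fun ω => H (fun i j => X 0 i j ω) l) 2 ν := by
    obtain ⟨B, -, hB⟩ := k.exists_abs_centred_le (m (a l).1) (m (b l).1)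
    exact MemLp.of_bound ((hHl l).comp (hXm' 0)).aestronglyMeasurable B
      (Eventually.of_forall fun ω => hB (X 0 (a l).1 (a l).2 ω) (X 0 (b l).1 (b l).2 ω))
  exact tendstoInDistribution_of_asymptotically_linear
    (fun n => measurable_pi_lambda _ fun l =>
      measurable_centredSum k (y := fun ω t => X t (a l).1 (a l).2 ω)
        (z := fun ω t => X t (b l).1 (b l).2 ω) (fun t => hXm t _ _) (fun t => hXm t _ _) n)
    hH2 (fun l => (hX 0).integral_centred k hP (hab l))
    (hindep.comp (fun _ => H) fun _ => hH) (fun t => ((hX t).identDistrib (hX 0)).comp hH)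
    (fun l => k.tendsto_lintegral_centredSum_sub (fun t => hXm t (a l).1 (a l).2)
      (fun t => hXm t (b l).1 (b l).2) (hXi _ _) (hXi _ _)
      (fun t => (hX t).inner_mean k hP _ _) (fun t => (hX t).inner_mean k hP _ _) _)
    hgm hg.hasFDerivAt

end Mixture

/-- Away from nonpositive variances g is smooth. Elsewhere `√` of a nonpositive number and division
by zero both give 0, which is exactly the convention for the correlation estimator. -/
lemma differentiableAt_div_sqrt_mul_sqrt {θ : Fin 3 → ℝ} (h1 : 0 < θ 1) (h2 : 0 < θ 2) :
    DifferentiableAt ℝ (fun x : Fin 3 → ℝ => x 0 / (√(x 1) * √(x 2))) θ := by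
  have h1' : θ 1 ≠ 0 := h1.ne'
  have h2' : θ 2 ≠ 0 := h2.ne'
  have h3 : √(θ 1) * √(θ 2) ≠ 0 := by positivity
  fun_prop (disch := assumption)

end KernelCorr

end

theorem mainTheorem5 {𝕏 : Type*} [TopologicalSpace 𝕏] [PolishSpace 𝕏] [LocallyCompactSpace 𝕏]
    [MeasurableSpace 𝕏] [BorelSpace 𝕏] (k : KernelCorr.BddKernel 𝕏)
    {Ω : Type*} [MeasurableSpace Ω] (μ : Measure Ω) [IsProbabilityMeasure μ]
    (P : Fin 2 → Ω → ProbabilityMeasure 𝕏) (hP : ∀ i, Measurable (P i))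
    (hvar : ∀ i, 0 < KernelCorr.kernelVar k μ (P i))
    {Ω' : Type*} [MeasurableSpace Ω'] (ν : Measure Ω') [IsProbabilityMeasure ν]
    (X : ℕ → Fin 2 → Fin 2 → Ω' → 𝕏)
    (hX : ∀ t, KernelCorr.IsPartiallyExchangeableSample μ P ν (X t))
    (hindep : iIndepFun (fun (t : ℕ) (ω : Ω') (i j : Fin 2) => X t i j ω) ν) :
    ∃ v : NNReal, TendstoInDistribution
      (fun (M : ℕ) (ω : Ω') =>
        √(M : ℝ) * (KernelCorr.corrEstimator k (fun t i j => X t i j ω) M -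
          KernelCorr.kernelCorr k μ (P 0) (P 1)))
      atTop (id : ℝ → ℝ) (fun _ => ν) (gaussianReal 0 v) := by
  have hg : DifferentiableAt ℝ (fun x : Fin 3 → ℝ => x 0 / (√(x 1) * √(x 2)))
      ![KernelCorr.kernelCov k μ (P 0) (P 1), KernelCorr.kernelVar k μ (P 0),
        KernelCorr.kernelVar k μ (P 1)] :=
    KernelCorr.differentiableAt_div_sqrt_mul_sqrt (hvar 0) (hvar 1)
  -- The three index pairs are the first observations of the two groups (covariance), then the two
  -- observations of each group (variances); a variance is the covariance of P i with itself.
  have hθ : (fun l => KernelCorr.kernelCov k μ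
      (P ((![(0, 0), (0, 0), (1, 0)] : Fin 3 → Fin 2 × Fin 2) l).1)
      (P ((![(1, 0), (0, 1), (1, 1)] : Fin 3 → Fin 2 × Fin 2) l).1)) =
      ![KernelCorr.kernelCov k μ (P 0) (P 1), KernelCorr.kernelVar k μ (P 0),
        KernelCorr.kernelVar k μ (P 1)] := by
    ext l
    fin_cases l <;> rfl
  exact KernelCorr.exists_tendstoInDistribution_centredSum k hP hX hindep
    (a := ![(0, 0), (0, 0), (1, 0)]) (b := ![(1, 0), (0, 1), (1, 1)])
    (fun l => by fin_cases l <;> simp) (by fun_prop) (hθ ▸ hg)
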